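/- Let $\mathcal H$ be a complex Hilbert space and let $\mathfrak N_1,\mathfrak N_2$ be properly infinite von Neumann algebras on $\mathcal H$ (that is, the only finite central projection of $\mathfrak N_i$ is $0$) such that $\mathfrak N_1\subseteq\mathfrak N_2'$ and $X_1X_2\neq 0$ for all nonzero operators $X_1\in\mathfrak N_1$ and $X_2\in\mathfrak N_2$. Let $\mathfrak N_1\vee\mathfrak N_2$ be the von Neumann algebra generated by $\mathfrak N_1$ and $\mathfrak N_2$. A normal state $\omega$ of $\mathfrak N_1\vee\mathfrak N_2$ is called an EPR state for a pair $(A_1,A_2)$ of commuting self-adjoint operators in $\mathfrak N_1\vee\mathfrak N_2$ if $\omega((A_1-A_2)^2)=0$, and it is called an EPR state for incommensurable pairs if there are projections $E_1,F_1\in\mathfrak N_1$ and $E_2,F_2\in\mathfrak N_2$ such that $\omega$ is an EPR state for $(E_1,E_2)$ and for $(F_1,F_2)$, $\omega(|[E_1,F_1]|^2)\neq 0$ and $\omega(|[E_2,F_2]|^2)\neq 0$, where $[A,B]=AB-BA$ and $|X|^2=X^*X$. Then for every unit vector $\Psi\in\mathcal H$ and every real $\epsilon>0$ there is a unit vector $\Psi'\in\mathcal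 H$ such that $\|\Psi-\Psi'\|<\epsilon$ and the vector state $A\mapsto\langle\Psi',A\Psi'\rangle$ of $\mathfrak N_1\vee\mathfrak N_2$ is an EPR state for incommensurable pairs. Consequently, the vector states of $\mathfrak N_1\vee\mathfrak N_2$ that are EPR states for incommensurable pairs are dense, in the norm of the dual space of $\mathfrak N_1\vee\mathfrak N_2$, in the set of all vector states of $\mathfrak N_1\vee\mathfrak N_2$. -/

import Mathlib

open scoped InnerProductSpace ComplexOrder

noncomputable section

namespace EPR

variable {H : Type*} [NormedAddCommGroup H] [InnerProductSpace ℂ H] [CompleteSpace H]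

/-- Murray-von Neumann equivalence of `p` and `q` relative to `M`: `p = v* v` and `q = v v*` for
some `v` in `M`. -/
def MvNEquiv (M : VonNeumannAlgebra H) (p q : H →L[ℂ] H) : Prop :=
  ∃ v ∈ M, star v * v = p ∧ v * star v = q

/-- `p` is a finite projection of `M`: it is a projection in `M` that is not equivalent to any
proper subprojection of itself in `M`. -/
def IsFiniteProjection (M : VonNeumannAlgebra H) (p : H →L[ℂ] H) : Prop :=
  IsStarProjection p ∧ p ∈ M ∧
    ∀ q ∈ M, IsStarProjection q → q ≤ p → MvNEquiv M p q → q = p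

/-- `M` is properly infinite: `0` is its only finite central projection. -/
def IsProperlyInfinite (M : VonNeumannAlgebra H) : Prop :=
  ∀ z ∈ M, z ∈ M.commutant → IsFiniteProjection M z → z = 0

/-- The von Neumann algebra `N₁ ∨ N₂` generated by `N₁` and `N₂`, that is, the double commutant
of `N₁ ∪ N₂` (see `coe_join`). -/
def join (N₁ N₂ : VonNeumannAlgebra H) : VonNeumannAlgebra H where
  toStarSubalgebra := StarSubalgebra.centralizer ℂ
    (StarSubalgebra.centralizer ℂ ((N₁ : Set (H →L[ℂ] H)) ∪ N₂) : Set (H →L[ℂ] H))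
  centralizer_centralizer' := by simp

theorem coe_join (N₁ N₂ : VonNeumannAlgebra H) :
    (join N₁ N₂ : Set (H →L[ℂ] H)) =
      Set.centralizer (Set.centralizer ((N₁ : Set (H →L[ℂ] H)) ∪ N₂)) := by
  have h : star ((N₁ : Set (H →L[ℂ] H)) ∪ N₂) = (N₁ : Set (H →L[ℂ] H)) ∪ N₂ := by
    ext x
    simp
  have h' : star (Set.centralizer ((N₁ : Set (H →L[ℂ] H)) ∪ N₂)) =
      Set.centralizer ((N₁ : Set (H →L[ℂ] H)) ∪ N₂) := by
    rw [Set.star_centralizer, h]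
  simp [join, h, h']

/-- A normal state of the von Neumann algebra `M`: a positive, unital, ultraweakly continuous
linear functional `ω` on `M`. A positive functional is ultraweakly continuous iff it is of the form
`ω(A) = ∑ ⟨ξₙ, A ξₙ⟩` with `∑ ‖ξₙ‖² < ∞`. -/
structure NormalState (M : VonNeumannAlgebra H) where
  /-- the functional -/
  toCLM : M.toStarSubalgebra →L[ℂ] ℂ
  nonneg : ∀ A : M.toStarSubalgebra, 0 ≤ toCLM (star A * A)
  map_one : toCLM 1 = 1
  normal : ∃ ξ : ℕ → H, Summable (fun n => ‖ξ n‖ ^ 2) ∧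
    ∀ A : M.toStarSubalgebra, HasSum (fun n => ⟪ξ n, (A : H →L[ℂ] H) (ξ n)⟫_ℂ) (toCLM A)

/-- The bounded functional `A ↦ ⟨Ψ, A Ψ⟩` on `M`. -/
def vectorFunctional (M : VonNeumannAlgebra H) (Ψ : H) : M.toStarSubalgebra →L[ℂ] ℂ :=
  LinearMap.mkContinuous
    { toFun := fun A => ⟪Ψ, (A : H →L[ℂ] H) Ψ⟫_ℂ
      map_add' := fun A B => by simp
      map_smul' := fun c A => by simp }
    (‖Ψ‖ * ‖Ψ‖) (fun A => by
      have h1 := norm_inner_le_norm (𝕜 := ℂ) Ψ ((A : H →L[ℂ] H) Ψ)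
      have h2 := (A : H →L[ℂ] H).le_opNorm Ψ
      have h3 : ‖(A : H →L[ℂ] H)‖ = ‖A‖ := rfl
      calc _ ≤ ‖Ψ‖ * ‖(A : H →L[ℂ] H) Ψ‖ := h1
        _ ≤ ‖Ψ‖ * (‖A‖ * ‖Ψ‖) := by rw [← h3]; gcongr
        _ = _ := by ring)

@[simp]
theorem vectorFunctional_apply (M : VonNeumannAlgebra H) (Ψ : H) (A : M.toStarSubalgebra) :
    vectorFunctional M Ψ A = ⟪Ψ, (A : H →L[ℂ] H) Ψ⟫_ℂ := rfl

/-- The vector state of `M` induced by the unit vector `Ψ`. -/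
def vectorState (M : VonNeumannAlgebra H) (Ψ : H) (hΨ : ‖Ψ‖ = 1) : NormalState M where
  toCLM := vectorFunctional M Ψ
  nonneg A := by
    have : vectorFunctional M Ψ (star A * A) =
        ⟪(A : H →L[ℂ] H) Ψ, (A : H →L[ℂ] H) Ψ⟫_ℂ := by
      simp [ContinuousLinearMap.star_eq_adjoint, ContinuousLinearMap.adjoint_inner_right]
    rw [this, inner_self_eq_norm_sq_to_K]
    rw [← RCLike.ofReal_pow]
    exact RCLike.ofReal_nonneg.mpr (sq_nonneg ‖(A : H →L[ℂ] H) Ψ‖)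
  map_one := by
    simp [inner_self_eq_norm_sq_to_K, hΨ]
  normal := by
    refine ⟨fun n => if n = 0 then Ψ else 0, ?_, fun A => ?_⟩
    · refine summable_of_ne_finset_zero (s := {0}) fun n hn => ?_
      simp_all
    · convert hasSum_ite_eq (0 : ℕ) (vectorFunctional M Ψ A) using 2 with n
      by_cases hn : n = 0 <;> simp [hn]

/-- `ω` is an EPR state for the commuting self-adjoint operators `A₁`, `A₂` in `M`. -/
def IsEPRFor {M : VonNeumannAlgebra H} (ω : NormalState M) (A₁ A₂ : M.toStarSubalgebra) : Prop :=
  IsSelfAdjoint A₁ ∧ IsSelfAdjoint A₂ ∧ Commute A₁ A₂ ∧ ω.toCLM ((A₁ - A₂) ^ 2) = 0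

/-- `|[A, B]|²`, that is, `[A, B]* [A, B]`. -/
def absCommSq {M : VonNeumannAlgebra H} (A B : M.toStarSubalgebra) : M.toStarSubalgebra :=
  star (A * B - B * A) * (A * B - B * A)

/-- The normal state `ω` of `N₁ ∨ N₂` is an EPR state for incommensurable pairs: there are
projections `E₁, F₁ ∈ N₁` and `E₂, F₂ ∈ N₂` such that `ω` is an EPR state for `(E₁, E₂)` and for
`(F₁, F₂)` while `ω(|[E₁, F₁]|²) ≠ 0` and `ω(|[E₂, F₂]|²) ≠ 0`. -/
def IsEPRIncommensurable (N₁ N₂ : VonNeumannAlgebra H) (ω : NormalState (join N₁ N₂)) : Prop :=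
  ∃ E₁ F₁ E₂ F₂ : (join N₁ N₂).toStarSubalgebra,
    (E₁ : H →L[ℂ] H) ∈ N₁ ∧ (F₁ : H →L[ℂ] H) ∈ N₁ ∧
    (E₂ : H →L[ℂ] H) ∈ N₂ ∧ (F₂ : H →L[ℂ] H) ∈ N₂ ∧
    IsStarProjection E₁ ∧ IsStarProjection F₁ ∧ IsStarProjection E₂ ∧ IsStarProjection F₂ ∧
    IsEPRFor ω E₁ E₂ ∧ IsEPRFor ω F₁ F₂ ∧
    ω.toCLM (absCommSq E₁ F₁) ≠ 0 ∧ ω.toCLM (absCommSq E₂ F₂) ≠ 0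

end EPR

end

/-! In a 2 × 2 system of matrix units, a projection onto a basis vector and the projection onto the
diagonal vector do not commute. Both are real symmetric, so on a maximally entangled vector |11⟩ +
|22⟩ of two commuting systems each agrees with its counterpart in the other factor
(`entangler_relations`). It therefore suffices to add a small entangled vector to a vector that all
the matrix units annihilate, since the agreement survives and the commutators see only the entangled
part.

That the annihilated vector can be near Ψ uses proper infiniteness: a nonunitary isometry v gives
infinitely many orthogonal equivalent projections vⁿ(1 - vv*)v*ⁿ, whose norms on Ψ tend to 0. A
partial isometry between two consecutive ones generates matrix units with unit small on Ψ
(`exists_partialIsometry_small`). The product hypothesis makes the entangled vectors nonzero. -/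

noncomputable section

namespace EPR

/-! ### Algebra of two commuting systems of matrix units -/

section Algebra

variable {R : Type*} [Ring R]

/-- The unit of the system of matrix units generated by `a` and `b`. -/
def unitProj (a b : R) : R := b * a + a * b

/-- The operator that maps onto maximally entangled vectors of two commuting systems of
matrix units. -/
def entangler (a b c d : R) : R := (1 + a * c) * (b * a) * (d * c)

variable {a b c d : R}

theorem mul_one_sub_unitProj (ha : a * a = 0) (hab : a * b * a = a) :
    a * (1 - unitProj a b) = 0 := by
  simp only [unitProj, mul_sub, mul_add, ← mul_assoc, ha, hab]
  simp

theorem mul_one_sub_unitProj' (hb : b * b = 0) (hba : b * a * b = b) :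
    b * (1 - unitProj a b) = 0 := by
  simp only [unitProj, mul_sub, mul_add, ← mul_assoc, hb, hba]
  simp

variable [Algebra ℂ R]

/-- The projection onto the diagonal vector of the system of `2 × 2` matrix units generated by a
partial isometry `a` of square zero with adjoint `b`. -/
def diagProj (a b : R) : R := (1 / 2 : ℂ) • (b * a + a + b + a * b)

theorem diagProj_mul_self (ha : a * a = 0) (hb : b * b = 0) (hab : a * b * a = a)
    (hba : b * a * b = b) : diagProj a b * diagProj a b = diagProj a b := by
  have ha' (x : R) : a * (a * x) = 0 := by rw [← mul_assoc, ha, zero_mul]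
  have hb' (x : R) : b * (b * x) = 0 := by rw [← mul_assoc, hb, zero_mul]
  rw [mul_assoc] at hab hba
  simp only [diagProj, smul_mul_smul_comm, mul_add, add_mul, mul_assoc, ha, hb, hab, hba, ha', hb',
    add_zero, zero_add, mul_zero]
  module

theorem mul_diagProj_sub (ha : a * a = 0) (hb : b * b = 0) (hab : a * b * a = a)
    (hba : b * a * b = b) :
    b * a * diagProj a b - diagProj a b * (b * a) = (1 / 2 : ℂ) • (b - a) := by
  have ha' (x : R) : a * (a * x) = 0 := by rw [← mul_assoc, ha, zero_mul]
  have hb' (x : R) : b * (b * x) = 0 := by rw [← mul_assoc, hb, zero_mul]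
  rw [mul_assoc] at hab hba
  simp only [diagProj, mul_smul_comm, smul_mul_assoc, mul_add, add_mul, mul_assoc, ha, hab, hba,
    ha', hb', add_zero, mul_zero]
  module

/-- With b * a and d * c projecting onto the first basis vectors, the entangler sends |11⟩ to |11⟩ +
|22⟩. The last two relations undo the commutator: (b - a) gives |12⟩ - |21⟩, from which d * (b * a)
recovers |11⟩, so the commutator cannot vanish there. -/
theorem entangler_relations (ha : a * a = 0) (hb : b * b = 0) (hab : a * b * a = a)
    (hc : c * c = 0) (hd : d * d = 0) (hcd : c * d * c = c) (hca : c * a = a * c)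
    (hcb : c * b = b * c) (hda : d * a = a * d)
    (hdb : d * b = b * d) :
    b * a * entangler a b c d = d * c * entangler a b c d ∧
    diagProj a b * entangler a b c d = diagProj c d * entangler a b c d ∧
    d * (b * a) * ((b - a) * entangler a b c d) = b * a * (d * c) ∧
    b * (d * c) * ((d - c) * entangler a b c d) = b * a * (d * c) := by
  have ha' (x : R) : a * (a * x) = 0 := by rw [← mul_assoc, ha, zero_mul]
  have hb' (x : R) : b * (b * x) = 0 := by rw [← mul_assoc, hb, zero_mul]
  have hd' (x : R) : d * (d * x) = 0 := by rw [← mul_assoc, hd, zero_mul]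
  rw [mul_assoc] at hab hcd
  have hab' (x : R) : a * (b * (a * x)) = a * x := by rw [← mul_assoc b, ← mul_assoc, hab]
  have hca' (x : R) : c * (a * x) = a * (c * x) := by rw [← mul_assoc, hca, mul_assoc]
  have hcb' (x : R) : c * (b * x) = b * (c * x) := by rw [← mul_assoc, hcb, mul_assoc]
  have hda' (x : R) : d * (a * x) = a * (d * x) := by rw [← mul_assoc, hda, mul_assoc]
  have hdb' (x : R) : d * (b * x) = b * (d * x) := by rw [← mul_assoc, hdb, mul_assoc]
  refine ⟨?_, ?_, ?_, ?_⟩ <;>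
  simp only [entangler, diagProj, smul_mul_assoc, mul_add, add_mul, sub_mul, one_mul, mul_assoc,
    ha', hb', hab', hc, hcd, hd', hca, hda, hca', hcb', hda', hdb', add_zero, zero_add, mul_zero,
    sub_zero, zero_sub, mul_neg, neg_zero]
  module

end Algebra

section Operators

variable {H : Type*} [NormedAddCommGroup H] [InnerProductSpace ℂ H]

/-- Normalizing y moves it by |‖y‖ - 1|, which is at most ‖x - y‖. -/
theorem norm_sub_normalize_le {x y : H} (hx : ‖x‖ = 1) :
    ‖x - (‖y‖⁻¹ : ℂ) • y‖ ≤ 2 * ‖x - y‖ := by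
  rcases eq_or_ne y 0 with rfl | hy
  · simp [hx]
  have hy' : ‖y‖ ≠ 0 := norm_ne_zero_iff.mpr hy
  have h : ‖y - (‖y‖⁻¹ : ℂ) • y‖ = |‖y‖ - ‖x‖| := by
    have e : y - (‖y‖⁻¹ : ℂ) • y = (((1 - ‖y‖⁻¹ : ℝ)) : ℂ) • y := by
      push_cast
      rw [sub_smul, one_smul]
    rw [e, norm_smul, Complex.norm_real, Real.norm_eq_abs, hx]
    nth_rw 2 [← abs_of_nonneg (norm_nonneg y)]
    rw [← abs_mul]
    field_simp
  calc _ = ‖(x - y) + (y - (‖y‖⁻¹ : ℂ) • y)‖ := by congr 1; abel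
    _ ≤ ‖x - y‖ + |‖y‖ - ‖x‖| := (norm_add_le _ _).trans_eq (by rw [h])
    _ ≤ ‖x - y‖ + ‖y - x‖ := by gcongr; exact abs_norm_sub_norm_le y x
    _ = 2 * ‖x - y‖ := by rw [norm_sub_rev y x]; ring

/-! ### Small partial isometries from a nonunitary isometry -/

variable [CompleteSpace H]

/-- If every isometry in N were unitary, 1 would be a finite central projection. -/
theorem exists_nonunitary_isometry [Nontrivial H] {N : VonNeumannAlgebra H}
    (hN : IsProperlyInfinite N) : ∃ v ∈ N, star v * v = 1 ∧ v * star v ≠ 1 := by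
  by_contra! h
  refine one_ne_zero (α := H →L[ℂ] H) (hN 1 (one_mem N) (one_mem _) ⟨.one _, one_mem N, ?_⟩)
  rintro q - - - ⟨v, hv, h1, rfl⟩
  exact h v hv h1

theorem norm_apply_of_star_mul_self {v : H →L[ℂ] H} (hv : star v * v = 1) (x : H) :
    ‖v x‖ = ‖x‖ := by
  have h : ⟪v x, v x⟫_ℂ = ⟪x, x⟫_ℂ := by
    rw [← ContinuousLinearMap.adjoint_inner_right, ← ContinuousLinearMap.star_eq_adjoint,
      ← mul_apply_eq_comp, hv, one_apply_eq_self]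
  rw [inner_self_eq_norm_sq_to_K, inner_self_eq_norm_sq_to_K] at h
  have h' : ‖v x‖ ^ 2 = ‖x‖ ^ 2 := by exact_mod_cast h
  exact (sq_eq_sq₀ (norm_nonneg _) (norm_nonneg _)).mp h'

/-- Pythagoras for the splitting of x along the range of v. -/
theorem norm_sq_one_sub_mul_star {v : H →L[ℂ] H} (hv : star v * v = 1) (x : H) :
    ‖(1 - v * star v) x‖ ^ 2 = ‖x‖ ^ 2 - ‖star v x‖ ^ 2 := by
  have e : ⟪v (star v x), (1 - v * star v) x⟫_ℂ = 0 := by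
    rw [← ContinuousLinearMap.adjoint_inner_right, ← ContinuousLinearMap.star_eq_adjoint,
      ← mul_apply_eq_comp, mul_sub, ← mul_assoc, hv]
    simp
  have h := norm_add_sq_eq_norm_sq_add_norm_sq_of_inner_eq_zero _ _ e
  have hx : v (star v x) + (1 - v * star v) x = x := by simp
  rw [hx, norm_apply_of_star_mul_self hv] at h
  nlinarith

/-- A properly infinite von Neumann algebra contains nonzero partial isometries of square zero
whose initial and final projections are arbitrarily small on a given vector. -/
theorem exists_partialIsometry_small [Nontrivial H] {N : VonNeumannAlgebra H}
    (hN : IsProperlyInfinite N) (Ψ : H) {δ : ℝ} (hδ : 0 < δ) :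
    ∃ w ∈ N, star w * w ≠ 0 ∧ w * w = 0 ∧ w * star w * w = w ∧
      ‖(star w * w) Ψ‖ < δ ∧ ‖(w * star w) Ψ‖ < δ := by
  obtain ⟨v, hvN, hv, hv1⟩ := exists_nonunitary_isometry hN
  set r := 1 - v * star v with hr
  have hr0 : r ≠ 0 := sub_ne_zero.mpr (Ne.symm hv1)
  have hrs : star r = r := by simp [hr]
  have hrv : r * v = 0 := by rw [hr, sub_mul, mul_assoc, hv]; simp
  have hrr : r * r = r := by
    conv_lhs => rw [hr, mul_sub, ← mul_assoc, ← hr, hrv]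
    simp
  have hrN : r ∈ N := sub_mem (one_mem N) (mul_mem hvN (star_mem hvN))
  have hpow (n : ℕ) : star (v ^ n) * v ^ n = 1 := by
    induction n with
    | zero => simp
    | succ n ih => rw [pow_succ, star_mul, mul_assoc, ← mul_assoc _ _ v, ih, one_mul, hv]
  have hpow' (n : ℕ) : star (v ^ n) * v ^ (n + 1) = v := by
    rw [pow_succ, ← mul_assoc, hpow, one_mul]
  -- The squared norms telescope along a nonnegative decreasing sequence, so they tend to 0.
  have hlim : Filter.Tendsto (fun n => ‖(v ^ n * r * star (v ^ n)) Ψ‖) Filter.atTop (nhds 0) := by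
    have key (n : ℕ) : ‖(v ^ n * r * star (v ^ n)) Ψ‖ ^ 2 =
        ‖star (v ^ n) Ψ‖ ^ 2 - ‖star (v ^ (n + 1)) Ψ‖ ^ 2 := by
      rw [mul_assoc, mul_apply_eq_comp, norm_apply_of_star_mul_self (hpow n),
        mul_apply_eq_comp, norm_sq_one_sub_mul_star hv, pow_succ v, star_mul,
        mul_apply_eq_comp]
    have hanti : Antitone fun n => ‖star (v ^ n) Ψ‖ ^ 2 :=
      antitone_nat_of_succ_le fun n => by
        have := key n
        nlinarith [sq_nonneg ‖(v ^ n * r * star (v ^ n)) Ψ‖]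
    have hconv := tendsto_atTop_ciInf hanti ⟨0, by rintro _ ⟨n, rfl⟩; positivity⟩
    have h2 := hconv.sub (hconv.comp (Filter.tendsto_add_atTop_nat 1))
    rw [sub_self] at h2
    have h3 : Filter.Tendsto (fun n => ‖(v ^ n * r * star (v ^ n)) Ψ‖ ^ 2) Filter.atTop
        (nhds 0) := h2.congr fun n => (key n).symm
    simpa using h3.sqrt
  -- The bound is needed at both n and n + 1: w maps the range of the nth projection onto that of
  -- the next.
  obtain ⟨n, hn⟩ := (hlim.eventually (gt_mem_nhds hδ)).exists_forall_of_atTop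
  set w := v ^ (n + 1) * r * star (v ^ n) with hw
  have hws : star w = v ^ n * r * star (v ^ (n + 1)) := by
    simp [hw, hrs, mul_assoc]
  have h1 : star w * w = v ^ n * r * star (v ^ n) := by
    calc _ = v ^ n * r * (star (v ^ (n + 1)) * v ^ (n + 1)) * r * star (v ^ n) := by
          rw [hws, hw]; simp only [mul_assoc]
      _ = v ^ n * (r * r) * star (v ^ n) := by rw [hpow]; simp only [mul_assoc, one_mul]
      _ = _ := by rw [hrr]
  have h2 : w * star w = v ^ (n + 1) * r * star (v ^ (n + 1)) := by
    calc _ = v ^ (n + 1) * r * (star (v ^ n) * v ^ n) * r * star (v ^ (n + 1)) := by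
          rw [hws, hw]; simp only [mul_assoc]
      _ = v ^ (n + 1) * (r * r) * star (v ^ (n + 1)) := by
          rw [hpow]; simp only [mul_assoc, one_mul]
      _ = _ := by rw [hrr]
  refine ⟨w, mul_mem (mul_mem (pow_mem hvN _) hrN) (star_mem (pow_mem hvN _)), ?_, ?_, ?_, ?_, ?_⟩
  · intro h0
    rw [h1] at h0
    apply hr0
    calc r = (star (v ^ n) * v ^ n) * r * (star (v ^ n) * v ^ n) := by rw [hpow]; simp
      _ = star (v ^ n) * (v ^ n * r * star (v ^ n)) * v ^ n := by simp only [mul_assoc]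
      _ = 0 := by rw [h0]; simp
  · calc w * w = v ^ (n + 1) * (r * (star (v ^ n) * v ^ (n + 1))) * r * star (v ^ n) := by
          rw [hw]; simp only [mul_assoc]
      _ = 0 := by rw [hpow', hrv]; simp
  · calc w * star w * w = v ^ (n + 1) * r * (star (v ^ (n + 1)) * v ^ (n + 1)) * r *
          star (v ^ n) := by rw [h2, hw]; simp only [mul_assoc]
      _ = v ^ (n + 1) * (r * r) * star (v ^ n) := by rw [hpow]; simp only [mul_assoc, one_mul]
      _ = w := by rw [hrr]
  · rw [h1]; exact hn n le_rfl
  · rw [h2]; exact hn (n + 1) n.le_succ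

/-! ### Projections from matrix units, and vector states -/

theorem isStarProjection_star_mul_self {w : H →L[ℂ] H} (hw : w * star w * w = w) :
    IsStarProjection (star w * w) :=
  ⟨by rw [IsIdempotentElem, mul_assoc, ← mul_assoc w, hw], .star_mul_self w⟩

theorem star_mul_mul_star {w : H →L[ℂ] H} (hw : w * star w * w = w) :
    star w * w * star w = star w := by
  have := congrArg star hw
  simpa [mul_assoc] using this

theorem isStarProjection_diagProj {w : H →L[ℂ] H} (h0 : w * w = 0) (hw : w * star w * w = w) :
    IsStarProjection (diagProj w (star w)) := by
  refine ⟨diagProj_mul_self h0 (by rw [← star_mul, h0, star_zero]) hw (star_mul_mul_star hw), ?_⟩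
  simp only [IsSelfAdjoint, diagProj, star_smul, star_add, star_mul, star_star]
  congr 1
  · simp
  · abel

theorem diagProj_mem {N : VonNeumannAlgebra H} {w : H →L[ℂ] H} (hw : w ∈ N) :
    diagProj w (star w) ∈ N :=
  N.toStarSubalgebra.smul_mem (add_mem (add_mem (add_mem (mul_mem (star_mem hw) hw) hw)
    (star_mem hw)) (mul_mem hw (star_mem hw))) _

theorem norm_apply_le_of_isStarProjection {p : H →L[ℂ] H} (hp : IsStarProjection p) (x : H) :
    ‖p x‖ ≤ ‖x‖ :=
  (p.le_opNorm x).trans (mul_le_of_le_one_left (norm_nonneg x) hp.norm_le)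

theorem le_join_left (N₁ N₂ : VonNeumannAlgebra H) {x : H →L[ℂ] H} (hx : x ∈ N₁) :
    x ∈ join N₁ N₂ := by
  rw [← SetLike.mem_coe, coe_join]
  exact Set.subset_centralizer_centralizer (Or.inl hx)

theorem le_join_right (N₁ N₂ : VonNeumannAlgebra H) {x : H →L[ℂ] H} (hx : x ∈ N₂) :
    x ∈ join N₁ N₂ := by
  rw [← SetLike.mem_coe, coe_join]
  exact Set.subset_centralizer_centralizer (Or.inr hx)

theorem commute_of_le_commutant {N₁ N₂ : VonNeumannAlgebra H} (h : N₁ ≤ N₂.commutant)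
    {x y : H →L[ℂ] H} (hx : x ∈ N₁) (hy : y ∈ N₂) : y * x = x * y :=
  VonNeumannAlgebra.mem_commutant_iff.mp (h hx) y hy

theorem absCommSq_vectorState_ne_zero {M : VonNeumannAlgebra H} {Ψ : H} (hΨ : ‖Ψ‖ = 1)
    {A B : M.toStarSubalgebra}
    (h : ((A : H →L[ℂ] H) * B - (B : H →L[ℂ] H) * A) Ψ ≠ 0) :
    (vectorState M Ψ hΨ).toCLM (absCommSq A B) ≠ 0 := by
  have e : (vectorState M Ψ hΨ).toCLM (absCommSq A B) =
      ⟪((A : H →L[ℂ] H) * B - (B : H →L[ℂ] H) * A) Ψ,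
        ((A : H →L[ℂ] H) * B - (B : H →L[ℂ] H) * A) Ψ⟫_ℂ := by
    rw [← ContinuousLinearMap.adjoint_inner_right, ← ContinuousLinearMap.star_eq_adjoint]
    rfl
  rw [e]
  exact inner_self_ne_zero.mpr h

theorem isEPRFor_vectorState {M : VonNeumannAlgebra H} {Ψ : H} (hΨ : ‖Ψ‖ = 1)
    {A B : M.toStarSubalgebra} (hA : IsSelfAdjoint A) (hB : IsSelfAdjoint B) (hAB : Commute A B)
    (h : (A : H →L[ℂ] H) Ψ = (B : H →L[ℂ] H) Ψ) : IsEPRFor (vectorState M Ψ hΨ) A B := by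
  refine ⟨hA, hB, hAB, ?_⟩
  have e : (vectorState M Ψ hΨ).toCLM ((A - B) ^ 2) =
      ⟪Ψ, ((A : H →L[ℂ] H) - B) (((A : H →L[ℂ] H) - B) Ψ)⟫_ℂ := by
    rw [sq]
    rfl
  rw [e, sub_apply _ _ Ψ, h, sub_self, map_zero, inner_zero_right]

theorem isStarProjection_mk {M : VonNeumannAlgebra H} {p : H →L[ℂ] H} (hp : IsStarProjection p)
    (hM : p ∈ M.toStarSubalgebra) : IsStarProjection (⟨p, hM⟩ : M.toStarSubalgebra) :=
  ⟨Subtype.ext hp.isIdempotentElem.eq, Subtype.ext hp.isSelfAdjoint.star_eq⟩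

/-! ### Construction of the nearby vector -/

/-- A vector close to `Ψ` on which two commuting pairs of matrix units are maximally correlated
induces an EPR state for incommensurable pairs. -/
theorem exists_isEPRIncommensurable_near {N₁ N₂ : VonNeumannAlgebra H}
    (hN₁ : IsProperlyInfinite N₁) (hN₂ : IsProperlyInfinite N₂) (hcomm : N₁ ≤ N₂.commutant)
    (hprod : ∀ X₁ ∈ N₁, ∀ X₂ ∈ N₂, X₁ ≠ 0 → X₂ ≠ 0 → X₁ * X₂ ≠ 0)
    {Ψ : H} (hΨ : ‖Ψ‖ = 1) {ε : ℝ} (hε : 0 < ε) :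
    ∃ (Ψ' : H) (hΨ' : ‖Ψ'‖ = 1), ‖Ψ - Ψ'‖ < ε ∧
      IsEPRIncommensurable N₁ N₂ (vectorState (join N₁ N₂) Ψ' hΨ') := by
  have : Nontrivial H := ⟨Ψ, 0, by rintro rfl; simp at hΨ⟩
  -- P and Q are each a sum of two small projections, so each has norm below ε / 8 on Ψ.
  have hδ : 0 < ε / 16 := by positivity
  obtain ⟨a, haN, hane, ha, hab, hai, haf⟩ := exists_partialIsometry_small hN₁ Ψ hδ
  obtain ⟨c, hcN, hcne, hc, hcd, hci, hcf⟩ := exists_partialIsometry_small hN₂ Ψ hδ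
  set b := star a with hb_def
  set d := star c with hd_def
  have hbN : b ∈ N₁ := star_mem haN
  have hdN : d ∈ N₂ := star_mem hcN
  have hb : b * b = 0 := by rw [hb_def, ← star_mul, ha, star_zero]
  have hd : d * d = 0 := by rw [hd_def, ← star_mul, hc, star_zero]
  have hba : b * a * b = b := star_mul_mul_star hab
  have hdc : d * c * d = d := star_mul_mul_star hcd
  have hE₁ : IsStarProjection (b * a) := isStarProjection_star_mul_self hab
  have hE₂ : IsStarProjection (d * c) := isStarProjection_star_mul_self hcd
  have hF₁ : IsStarProjection (diagProj a b) := isStarProjection_diagProj ha hab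
  have hF₂ : IsStarProjection (diagProj c d) := isStarProjection_diagProj hc hcd
  have hab' : IsStarProjection (a * b) := by
    have := isStarProjection_star_mul_self (w := b) (by rw [hb_def, star_star]; exact hba)
    rwa [hb_def, star_star] at this
  have hCom {x y : H →L[ℂ] H} (hx : x ∈ N₁) (hy : y ∈ N₂) : y * x = x * y :=
    commute_of_le_commutant hcomm hx hy
  obtain ⟨hTE, hTF, hT₁, hT₂⟩ := entangler_relations ha hb hab hc hd hcd (hCom haN hcN)
    (hCom hbN hcN) (hCom haN hdN) (hCom hbN hdN)
  set T := entangler a b c d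
  have hE₁N : b * a ∈ N₁ := mul_mem hbN haN
  have hE₂N : d * c ∈ N₂ := mul_mem hdN hcN
  have hF₁N : diagProj a b ∈ N₁ := diagProj_mem haN
  have hF₂N : diagProj c d ∈ N₂ := diagProj_mem hcN
  obtain ⟨ζ, hζ⟩ : ∃ ζ, (b * a * (d * c)) ζ ≠ 0 := by
    by_contra! h
    exact hprod _ hE₁N _ hE₂N hane hcne (ContinuousLinearMap.ext h)
  set P := unitProj a b
  set Q := unitProj c d
  have hPN : P ∈ N₁ := add_mem hE₁N (mul_mem haN hbN)
  have hQN : Q ∈ N₂ := add_mem hE₂N (mul_mem hcN hdN)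
  have hPQ : (1 - P) * (1 - Q) = (1 - Q) * (1 - P) := by
    have := hCom hPN hQN
    simp only [mul_sub, sub_mul, mul_one, one_mul, this]
    abel
  have haP : a * ((1 - P) * (1 - Q)) = 0 := by
    rw [← mul_assoc, mul_one_sub_unitProj ha hab, zero_mul]
  have hbP : b * ((1 - P) * (1 - Q)) = 0 := by
    rw [← mul_assoc, mul_one_sub_unitProj' hb hba, zero_mul]
  have hcQ : c * ((1 - P) * (1 - Q)) = 0 := by
    rw [hPQ, ← mul_assoc, mul_one_sub_unitProj hc hcd, zero_mul]
  have hdQ : d * ((1 - P) * (1 - Q)) = 0 := by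
    rw [hPQ, ← mul_assoc, mul_one_sub_unitProj' hd hdc, zero_mul]
  set S := (1 - P) * (1 - Q)
  -- The + 1 keeps the denominator positive; the entangled term has norm at most ε / 8.
  set t : ℝ := ε / (8 * (‖T ζ‖ + 1)) with ht
  have hTζ : 0 ≤ ‖T ζ‖ := norm_nonneg _
  have ht0 : 0 < t := by positivity
  have htT : t * ‖T ζ‖ ≤ ε / 8 := by
    rw [ht, div_mul_eq_mul_div, div_le_div_iff₀ (by positivity) (by norm_num)]
    nlinarith
  set Φ := S Ψ + (t : ℂ) • T ζ with hΦ
  -- S kills the unperturbed part, so operators built from the matrix units act on Φ only through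
  -- the entangled term.
  have hcalc (X Y : H →L[ℂ] H) (hX : X * S = 0) (hXT : X * T = Y) :
      X Φ = (t : ℂ) • Y ζ := by
    rw [hΦ, map_add, map_smul, ← mul_apply_eq_comp, ← mul_apply_eq_comp,
      hX, hXT, zero_apply, zero_add]
  have hE : (b * a) Φ = (d * c) Φ := by
    rw [hcalc _ _ (by rw [mul_assoc, haP, mul_zero]) hTE,
      hcalc (d * c) _ (by rw [mul_assoc, hcQ, mul_zero]) rfl]
  have hF : diagProj a b Φ = diagProj c d Φ := by
    rw [hcalc _ _ _ hTF, hcalc (diagProj c d) _ _ rfl]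
    · simp only [diagProj, smul_mul_assoc, add_mul, mul_assoc, hcQ, hdQ, mul_zero]; simp
    · simp only [diagProj, smul_mul_assoc, add_mul, mul_assoc, haP, hbP, mul_zero]; simp
  have htC : (t : ℂ) ≠ 0 := by exact_mod_cast ht0.ne'
  have hC₁ : (b - a) Φ ≠ 0 := by
    intro h0
    have h := hcalc _ _ (by rw [mul_assoc, sub_mul, haP, hbP]; simp) ((mul_assoc _ _ _).trans hT₁)
    rw [mul_apply_eq_comp, h0, map_zero] at h
    exact smul_ne_zero htC hζ h.symm
  have hC₂ : (d - c) Φ ≠ 0 := by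
    intro h0
    have h := hcalc _ _ (by rw [mul_assoc, sub_mul, hcQ, hdQ]; simp) ((mul_assoc _ _ _).trans hT₂)
    rw [mul_apply_eq_comp, h0, map_zero] at h
    exact smul_ne_zero htC hζ h.symm
  have hΦ0 : Φ ≠ 0 := by rintro h; rw [h, map_zero] at hC₁; exact hC₁ rfl
  have hPΨ : ‖P Ψ‖ < ε / 8 := by
    calc ‖P Ψ‖ ≤ ‖(b * a) Ψ‖ + ‖(a * b) Ψ‖ := norm_add_le _ _
      _ < ε / 8 := by linarith
  have hQΨ : ‖Q Ψ‖ < ε / 8 := by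
    calc ‖Q Ψ‖ ≤ ‖(d * c) Ψ‖ + ‖(c * d) Ψ‖ := norm_add_le _ _
      _ < ε / 8 := by linarith
  have hPproj : IsStarProjection P := by
    refine ⟨?_, hE₁.isSelfAdjoint.add hab'.isSelfAdjoint⟩
    have h0 : P * (1 - P) = 0 := by
      rw [show P = b * a + a * b from rfl, add_mul, mul_assoc, mul_assoc]
      change b * (a * (1 - P)) + a * (b * (1 - P)) = 0
      rw [mul_one_sub_unitProj ha hab, mul_one_sub_unitProj' hb hba]; simp
    rw [mul_sub, mul_one, sub_eq_zero] at h0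
    exact h0.symm
  -- Three errors below or at ε / 8 leave room under ε / 2, because normalization can double the
  -- distance.
  have hdist : ‖Ψ - Φ‖ < ε / 2 := by
    have e : Ψ - Φ = P Ψ + (1 - P) (Q Ψ) - (t : ℂ) • T ζ := by
      rw [hΦ, show S Ψ = (1 - P) ((1 - Q) Ψ) from rfl]
      simp only [sub_apply, one_apply_eq_self, map_sub]
      abel
    have h1 : ‖(1 - P) (Q Ψ)‖ ≤ ‖Q Ψ‖ := norm_apply_le_of_isStarProjection hPproj.one_sub _
    have h2 : ‖(t : ℂ) • T ζ‖ = t * ‖T ζ‖ := by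
      rw [norm_smul, Complex.norm_real, Real.norm_of_nonneg ht0.le]
    rw [e]
    have h3 := norm_sub_le (P Ψ + (1 - P) (Q Ψ)) ((t : ℂ) • T ζ)
    have h4 := norm_add_le (P Ψ) ((1 - P) (Q Ψ))
    linarith
  have hs : (‖Φ‖⁻¹ : ℂ) ≠ 0 := by simpa using hΦ0
  have hnorm : ‖(‖Φ‖⁻¹ : ℂ) • Φ‖ = 1 := by
    rw [norm_smul]
    simp [hΦ0]
  have hScale {X : H →L[ℂ] H} (hX : X Φ ≠ 0) :
      ((1 / 2 : ℂ) • X) ((‖Φ‖⁻¹ : ℂ) • Φ) ≠ 0 := by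
    rw [smul_apply, map_smul]
    exact smul_ne_zero (by norm_num) (smul_ne_zero hs hX)
  refine ⟨(‖Φ‖⁻¹ : ℂ) • Φ, hnorm, (norm_sub_normalize_le hΨ).trans_lt (by linarith),
    ⟨b * a, le_join_left N₁ N₂ hE₁N⟩, ⟨diagProj a b, le_join_left N₁ N₂ hF₁N⟩,
    ⟨d * c, le_join_right N₁ N₂ hE₂N⟩, ⟨diagProj c d, le_join_right N₁ N₂ hF₂N⟩,
    hE₁N, hF₁N, hE₂N, hF₂N, isStarProjection_mk hE₁ _, isStarProjection_mk hF₁ _,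
    isStarProjection_mk hE₂ _, isStarProjection_mk hF₂ _, ?_, ?_, ?_, ?_⟩
  · refine isEPRFor_vectorState hnorm (isStarProjection_mk hE₁ _).isSelfAdjoint
      (isStarProjection_mk hE₂ _).isSelfAdjoint (Subtype.ext (hCom hE₁N hE₂N).symm) ?_
    simp only [map_smul, hE]
  · refine isEPRFor_vectorState hnorm (isStarProjection_mk hF₁ _).isSelfAdjoint
      (isStarProjection_mk hF₂ _).isSelfAdjoint (Subtype.ext (hCom hF₁N hF₂N).symm) ?_
    simp only [map_smul, hF]
  · apply absCommSq_vectorState_ne_zero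
    simp only [mul_diagProj_sub ha hb hab hba]
    exact hScale hC₁
  · apply absCommSq_vectorState_ne_zero
    simp only [mul_diagProj_sub hc hd hcd hdc]
    exact hScale hC₂

/-- Changing the two entries of ⟨Ψ, AΨ⟩ one at a time costs ‖A‖ ‖Ψ - Φ‖ each; this turns vector
approximation into density in the dual norm. -/
theorem norm_vectorFunctional_sub_le (M : VonNeumannAlgebra H) {Ψ Φ : H} (hΨ : ‖Ψ‖ = 1)
    (hΦ : ‖Φ‖ = 1) : ‖vectorFunctional M Ψ - vectorFunctional M Φ‖ ≤ 2 * ‖Ψ - Φ‖ := by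
  refine ContinuousLinearMap.opNorm_le_bound _ (by positivity) fun A => ?_
  have e : (vectorFunctional M Ψ - vectorFunctional M Φ) A =
      ⟪Ψ - Φ, (A : H →L[ℂ] H) Ψ⟫_ℂ + ⟪Φ, (A : H →L[ℂ] H) (Ψ - Φ)⟫_ℂ := by
    simp
  have h1 : ‖(A : H →L[ℂ] H) Ψ‖ ≤ ‖A‖ := by simpa [hΨ] using (A : H →L[ℂ] H).le_opNorm Ψ
  have h2 : ‖(A : H →L[ℂ] H) (Ψ - Φ)‖ ≤ ‖A‖ * ‖Ψ - Φ‖ := (A : H →L[ℂ] H).le_opNorm _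
  rw [e]
  calc _ ≤ ‖Ψ - Φ‖ * ‖(A : H →L[ℂ] H) Ψ‖ + ‖Φ‖ * ‖(A : H →L[ℂ] H) (Ψ - Φ)‖ :=
        (norm_add_le _ _).trans (add_le_add (norm_inner_le_norm _ _) (norm_inner_le_norm _ _))
    _ ≤ ‖Ψ - Φ‖ * ‖A‖ + 1 * (‖A‖ * ‖Ψ - Φ‖) := by rw [hΦ]; gcongr
    _ = 2 * ‖Ψ - Φ‖ * ‖A‖ := by ring

end Operators

end EPR

end

theorem theorem3 {H : Type*} [NormedAddCommGroup H] [InnerProductSpace ℂ H] [CompleteSpace H]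
    (N₁ N₂ : VonNeumannAlgebra H)
    (hN₁ : EPR.IsProperlyInfinite N₁) (hN₂ : EPR.IsProperlyInfinite N₂)
    (hcomm : N₁ ≤ N₂.commutant)
    (hprod : ∀ X₁ ∈ N₁, ∀ X₂ ∈ N₂, X₁ ≠ 0 → X₂ ≠ 0 → X₁ * X₂ ≠ 0) :
    (∀ Ψ : H, ‖Ψ‖ = 1 → ∀ ε : ℝ, 0 < ε →
      ∃ (Ψ' : H) (hΨ' : ‖Ψ'‖ = 1), ‖Ψ - Ψ'‖ < ε ∧
        EPR.IsEPRIncommensurable N₁ N₂ (EPR.vectorState (EPR.join N₁ N₂) Ψ' hΨ')) ∧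
    (∀ (Ψ : H) (hΨ : ‖Ψ‖ = 1), ∀ ε : ℝ, 0 < ε →
      ∃ (Ψ' : H) (hΨ' : ‖Ψ'‖ = 1),
        ‖(EPR.vectorState (EPR.join N₁ N₂) Ψ hΨ).toCLM -
          (EPR.vectorState (EPR.join N₁ N₂) Ψ' hΨ').toCLM‖ < ε ∧
        EPR.IsEPRIncommensurable N₁ N₂ (EPR.vectorState (EPR.join N₁ N₂) Ψ' hΨ')) := by
  refine ⟨fun Ψ hΨ ε hε =>
    EPR.exists_isEPRIncommensurable_near hN₁ hN₂ hcomm hprod hΨ hε, fun Ψ hΨ ε hε => ?_⟩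
  obtain ⟨Ψ', hΨ', hdist, hEPR⟩ :=
    EPR.exists_isEPRIncommensurable_near hN₁ hN₂ hcomm hprod hΨ (half_pos hε)
  exact ⟨Ψ', hΨ', (EPR.norm_vectorFunctional_sub_le _ hΨ hΨ').trans_lt (by linarith), hEPR⟩
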